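/- Let $\xi_1,\xi_2,\dots$ be random variables on a probability space $(\Omega,\mathbb P)$ with values in a measurable space $S$, put $\mathcal F_t=\sigma(\xi_1,\dots,\xi_t)$ ($\mathcal F_0$ trivial), let $\Pi$ be a probability distribution on $S$ (the stationary distribution), and let $\nu$ be a measure on $S$ with respect to which $\Pi$ and the laws of all $\xi_t$ are absolutely continuous. For $k\ge 1$ let $$\phi(k)=\sup\{\,2\,d_{TV}(\mathbb P(\xi_{t+k}\in\cdot\mid B),\Pi)\;:\;t\ge 1,\ B\in\mathcal F_t,\ \mathbb P(B)>0\,\},\qquad d_{TV}(P,Q)=\sup_A|P(A)-Q(A)|.$$ Let $X$ be a compact subset of a real normed space, let $R$ satisfy $\|w-v\|\le R$ for all $w,v\in X$, let $F:X\times S\to\mathbb R$ with $F(w;\cdot)$ measurable for each $w$, and let $G\ge 0$, $\lambda>0$. Assume: 1. (Boundedness) for $\nu$-almost every $s$, $F(\cdot;s)$ is convex and $G$-Lipschitz on $X$ and takes values in $[0,GR]$; 2. (Strong convexity) $f(w)=\int F(w;s)\,d\Pi(s)$ satisfies $f(v)\ge f(w)+\langle g,v-w\rangle+\frac{\lambda}{2}\|w-v\|^2$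 for all $w,v\in X$ and all $g\in\partial f(w)$, where $\partial f(w)$ is the set of continuous linear functionals $g$ with $f(v)\ge f(w)+\langle g,v-w\rangle$ for all $v\in X$; 3. (Online algorithm and regret) $w(1),\dots,w(n)\in X$, where $w(t)$ is $\mathcal F_{t-1}$-measurable, and $R_n$ is a real random variable such that for every fixed $u\in X$, almost surely $\sum_{t=1}^n [F(w(t);\xi_t)-F(u;\xi_t)]\le R_n$; 4. (Stability) there is a non-increasing sequence $\kappa(1)\ge\kappa(2)\ge\dots$ with $\kappa(t)\le G/(\lambda t)$ for $t\ge1$ and, almost surely, $\|w(t)-w(t+1)\|\le\kappa(t)$ for $1\le t<n$. Let $\hat w_n=\frac1n\sum_{t=1}^n w(t)$ and $w^*\in\arg\min_{w\in X}f(w)$. There is a universal constant $C$ (depending on none of the data above) such that for all $n\ge 3$ and $0<\delta<1/e$, with probability at least $1-\delta\log n$, $$f(\hat w_n)-f(w^*)\le\frac{2R_n}{n}+C\inf_{\tau\in\{1,2,\dots\}}\left[\frac{(\tau-1)G^2}{\lambda n}\log n+\frac{\tau G^2}{\lambda n}\log\frac{\tau}{\delta}+\frac{G^2}{\lambda}\phi(\tau)\right].$$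 -/

import Mathlib

open MeasureTheory ProbabilityTheory

namespace OnlineMixing

/-- Total variation distance `sup_A |P(A) - Q(A)|` over measurable sets `A`
(a supremum of reals in `[0, 1]` when `P` and `Q` are probability measures). -/
noncomputable def tvDist {S : Type*} [MeasurableSpace S] (P Q : Measure S) : ℝ :=
  ⨆ A : {A : Set S // MeasurableSet A}, |P.real A.1 - Q.real A.1|

/-- The σ-field `𝓕_t = σ(ξ_1, …, ξ_t)`; samples are numbered from `1` (the value `ξ 0` is never
used) and `𝓕_0` is trivial. -/
abbrev pastSigma {Ω S : Type*} [MeasurableSpace S] (ξ : ℕ → Ω → S) (t : ℕ) : MeasurableSpace Ω :=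
  ⨆ i ∈ Finset.Icc 1 t, MeasurableSpace.comap (ξ i) inferInstance

/-- The weak `φ`-mixing coefficient
`φ(k) = sup { 2 d_TV(ℙ(ξ_{t+k} ∈ · | B), stat) : t ≥ 1, B ∈ 𝓕_t, ℙ(B) > 0 }`. -/
noncomputable def phiMixing {Ω S : Type*} [MeasurableSpace Ω] [MeasurableSpace S]
    (P : Measure Ω) (ξ : ℕ → Ω → S) (stat : Measure S) (k : ℕ) : ℝ :=
  ⨆ p : {p : ℕ × Set Ω // 1 ≤ p.1 ∧ MeasurableSet[pastSigma ξ p.1] p.2 ∧ P p.2 ≠ 0},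
    2 * tvDist ((P[|p.1.2]).map (ξ (p.1.1 + k))) stat

/-- The expected loss `f(w) = ∫ F(w; s) d stat(s)` under the stationary distribution. -/
noncomputable def risk {E S : Type*} [MeasurableSpace S] (F : E → S → ℝ) (stat : Measure S)
    (w : E) : ℝ :=
  ∫ s, F w s ∂stat

/-- Boundedness assumption on the losses and on the domain: for `ν`-almost every sample `s` the
loss `F(·; s)` is convex and `G`-Lipschitz on `X` with values in `[0, G R]`, and `X` is compact
with any two of its points at distance at most `R`. -/
structure BoundedLoss {E S : Type*} [NormedAddCommGroup E] [NormedSpace ℝ E] [MeasurableSpace S]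
    (X : Set E) (F : E → S → ℝ) (ν : Measure S) (G R : ℝ) : Prop where
  convex : ∀ᵐ s ∂ν, ConvexOn ℝ X (fun w => F w s)
  lipschitz : ∀ᵐ s ∂ν, ∀ v ∈ X, ∀ w ∈ X, |F v s - F w s| ≤ G * ‖v - w‖
  compact : IsCompact X
  radius : ∀ v ∈ X, ∀ w ∈ X, ‖v - w‖ ≤ R
  range : ∀ᵐ s ∂ν, ∀ w ∈ X, F w s ∈ Set.Icc 0 (G * R)

/-- The subdifferential at `w` of a function `f` on the domain `X`. -/
def subdiff {E : Type*} [NormedAddCommGroup E] [NormedSpace ℝ E] (X : Set E) (f : E → ℝ)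
    (w : E) : Set (E →L[ℝ] ℝ) :=
  {g | ∀ v ∈ X, f w + g (v - w) ≤ f v}

/-- `f` is `lam`-strongly convex on `X` with respect to the norm, in terms of subgradients. -/
def StronglyConvex {E : Type*} [NormedAddCommGroup E] [NormedSpace ℝ E] (X : Set E) (f : E → ℝ)
    (lam : ℝ) : Prop :=
  ∀ w ∈ X, ∀ v ∈ X, ∀ g ∈ subdiff X f w, f w + g (v - w) + lam / 2 * ‖w - v‖ ^ 2 ≤ f v

/-- `w(1), …, w(n)` are points of `X` chosen by an online algorithm: `w(t)` is a (measurable)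
function of the samples `ξ_1, …, ξ_{t-1}`. -/
def IsOnlineOutput {Ω E S : Type*} [MeasurableSpace E] [MeasurableSpace S] (X : Set E)
    (ξ : ℕ → Ω → S) (w : ℕ → Ω → E) (n : ℕ) : Prop :=
  ∀ t, 1 ≤ t → t ≤ n → Measurable[pastSigma ξ (t - 1)] (w t) ∧ ∀ ω, w t ω ∈ X

/-- Stability: `κ(1) ≥ κ(2) ≥ …` and, almost surely, `‖w(t) - w(t+1)‖ ≤ κ(t)` for the successive
iterates among `w(1), …, w(n)`. -/
def IsStable {Ω E : Type*} [MeasurableSpace Ω] [NormedAddCommGroup E] (P : Measure Ω)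
    (w : ℕ → Ω → E) (κ : ℕ → ℝ) (n : ℕ) : Prop :=
  AntitoneOn κ (Set.Ici 1) ∧
    ∀ t, 1 ≤ t → t < n → ∀ᵐ ω ∂P, ‖w t ω - w (t + 1) ω‖ ≤ κ t

/-- The (random) quantity `Rn` bounds the regret of `w(1), …, w(n)` on the samples
`ξ_1, …, ξ_n` against every fixed `u ∈ X`. -/
def HasRegret {Ω E S : Type*} [MeasurableSpace Ω] (P : Measure Ω) (X : Set E)
    (F : E → S → ℝ) (ξ : ℕ → Ω → S) (w : ℕ → Ω → E) (n : ℕ) (Rn : Ω → ℝ) : Prop :=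
  ∀ u ∈ X, ∀ᵐ ω ∂P, ∑ t ∈ Finset.Icc 1 n, (F (w t ω) (ξ t ω) - F u (ξ t ω)) ≤ Rn ω

/-- The averaged predictor `(1/n) ∑_{t=1}^n w(t)`. -/
noncomputable def avgPredictor {Ω E : Type*} [NormedAddCommGroup E] [NormedSpace ℝ E]
    (w : ℕ → Ω → E) (n : ℕ) (ω : Ω) : E :=
  (n : ℝ)⁻¹ • ∑ t ∈ Finset.Icc 1 n, w t ω

end OnlineMixing

open scoped ENNReal

namespace OnlineMixing

/-! Strong convexity makes the excess loss `l = F u - F xstar` self-bounding. Write `d = ‖u -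
xstar‖` and `Δ` for the excess risk of `u`. Then `l² ≤ G² d²`, while quadratic growth at the
minimizer gives `lam / 2 * d² ≤ Δ`. With `η = lam / (4 G²)`, the stationary mean of `exp (-η l)` is
therefore at most `exp (-η Δ / 2)`: a Bernstein bound whose variance is absorbed by the mean, which
yields the rate `1/n`.

For dependent samples, `w(t)` is tested on `ξ_{t+d}`, which lies `τ = d + 1` steps after the past
that determines `w(t)` (here `d` is the delay). Mixing replaces the conditional law by `stat` at a
cost `φ(τ)` (`setLIntegral_exp_le`). Indices in one residue class mod `τ` then form an exponential
supermartingale, and averaging the `τ` classes by Jensen gives a Chernoff bound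
(`measure_sum_ge_le`).

Stability moves the samples back from `t + d` to `t` at a cost of order `d (G²/lam) log n`
(`sum_shift_le`). There the regret bound applies, and convexity passes to the averaged predictor. -/

theorem pastSigma_mono {Ω S : Type*} [MeasurableSpace S] (ξ : ℕ → Ω → S) : Monotone (pastSigma ξ) := fun _ _ h =>
  biSup_mono fun _ hi => Finset.Icc_subset_Icc_right h hi

theorem measurable_pastSigma {Ω S : Type*} [MeasurableSpace S] (ξ : ℕ → Ω → S) {i t : ℕ} (hi : 1 ≤ i) (hit : i ≤ t) :
    Measurable[pastSigma ξ t] (ξ i) := by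
  rw [measurable_iff_comap_le]
  exact le_iSup₂_of_le i (Finset.mem_Icc.2 ⟨hi, hit⟩) le_rfl

/-! ### Total variation, mixing, and a Chernoff bound with delay -/

section Probability

variable {Ω S : Type*} [mΩ : MeasurableSpace Ω] [MeasurableSpace S]

theorem bddAbove_range_tv (P Q : Measure S) [IsProbabilityMeasure P] [IsProbabilityMeasure Q] :
    BddAbove (Set.range fun A : {A : Set S // MeasurableSet A} => |P.real A.1 - Q.real A.1|) := by
  refine ⟨1, ?_⟩
  rintro _ ⟨A, rfl⟩
  have h1 : P.real A.1 ≤ 1 := measureReal_le_one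
  have h2 : Q.real A.1 ≤ 1 := measureReal_le_one
  have h3 : 0 ≤ P.real A.1 := measureReal_nonneg
  have h4 : 0 ≤ Q.real A.1 := measureReal_nonneg
  exact abs_sub_le_iff.2 ⟨by linarith, by linarith⟩

theorem tvDist_nonneg (P Q : Measure S) : 0 ≤ tvDist P Q :=
  Real.iSup_nonneg fun _ => abs_nonneg _

theorem tvDist_le_one (P Q : Measure S) [IsProbabilityMeasure P] [IsProbabilityMeasure Q] :
    tvDist P Q ≤ 1 := by
  have : Nonempty {A : Set S // MeasurableSet A} := ⟨⟨∅, MeasurableSet.empty⟩⟩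
  refine ciSup_le fun A => ?_
  have h1 : P.real A.1 ≤ 1 := measureReal_le_one
  have h2 : Q.real A.1 ≤ 1 := measureReal_le_one
  have h3 : 0 ≤ P.real A.1 := measureReal_nonneg
  have h4 : 0 ≤ Q.real A.1 := measureReal_nonneg
  exact abs_sub_le_iff.2 ⟨by linarith, by linarith⟩

theorem measure_le_add_tvDist (P Q : Measure S) [IsProbabilityMeasure P] [IsProbabilityMeasure Q]
    {A : Set S} (hA : MeasurableSet A) : P A ≤ Q A + ENNReal.ofReal (tvDist P Q) := by
  have h : |P.real A - Q.real A| ≤ tvDist P Q := le_ciSup (bddAbove_range_tv P Q) ⟨A, hA⟩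
  have h' : P.real A ≤ Q.real A + tvDist P Q := by linarith [le_abs_self (P.real A - Q.real A)]
  rw [← ofReal_measureReal (μ := P), ← ofReal_measureReal (μ := Q),
    ← ENNReal.ofReal_add measureReal_nonneg (tvDist_nonneg P Q)]
  exact ENNReal.ofReal_le_ofReal h'

/-- Expectations of functions with values in `[0, M]` differ by at most `M` times the total
variation distance. -/
theorem lintegral_le_add_tvDist (P Q : Measure S) [IsProbabilityMeasure P]
    [IsProbabilityMeasure Q] {f : S → ℝ} (hf : Measurable f) (h0 : ∀ s, 0 ≤ f s) {M : ℝ}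
    (hM : ∀ᵐ s ∂P, f s ≤ M) :
    ∫⁻ s, ENNReal.ofReal (f s) ∂P
      ≤ ∫⁻ s, ENNReal.ofReal (f s) ∂Q + ENNReal.ofReal M * ENNReal.ofReal (tvDist P Q) := by
  rw [lintegral_eq_lintegral_meas_le P (.of_forall h0) hf.aemeasurable,
    lintegral_eq_lintegral_meas_le Q (.of_forall h0) hf.aemeasurable]
  -- Layer cake: the `P`-tails above `M` vanish, so the error `tvDist P Q` is integrated only over
  -- `(0, M]`.
  calc ∫⁻ t in Set.Ioi 0, P {a | t ≤ f a}
      ≤ ∫⁻ t in Set.Ioi 0, (Q {a | t ≤ f a}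
          + (Set.Iic M).indicator (fun _ => ENNReal.ofReal (tvDist P Q)) t) := by
        refine lintegral_mono fun t => ?_
        by_cases ht : t ≤ M
        · rw [Set.indicator_of_mem (Set.mem_Iic.2 ht)]
          exact measure_le_add_tvDist P Q (hf measurableSet_Ici)
        · have : P {a | t ≤ f a} = 0 := by
            refine measure_mono_null (fun a ha => ?_) (ae_iff.1 hM)
            exact fun h => ht (le_trans ha h)
          simp [this]
    _ = (∫⁻ t in Set.Ioi 0, Q {a | t ≤ f a})
          + ENNReal.ofReal M * ENNReal.ofReal (tvDist P Q) := by
        rw [lintegral_add_right _ (measurable_const.indicator measurableSet_Iic),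
          lintegral_indicator_const measurableSet_Iic, Measure.restrict_apply measurableSet_Iic,
          Set.inter_comm, Set.Ioi_inter_Iic, Real.volume_Ioc, sub_zero, mul_comm]

theorem pastSigma_le {ξ : ℕ → Ω → S} (hξ : ∀ t, 1 ≤ t → Measurable (ξ t)) (t : ℕ) :
    pastSigma ξ t ≤ mΩ :=
  iSup₂_le fun i hi => (hξ i (Finset.mem_Icc.1 hi).1).comap_le

theorem isProbabilityMeasure_map_cond {P : Measure Ω} [IsProbabilityMeasure P] {B : Set Ω}
    (hB : P B ≠ 0) {Y : Ω → S} (hY : Measurable Y) :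
    IsProbabilityMeasure ((P[|B]).map Y) := by
  have := cond_isProbabilityMeasure hB
  exact Measure.isProbabilityMeasure_map hY.aemeasurable

theorem phiMixing_nonneg (P : Measure Ω) (ξ : ℕ → Ω → S) (stat : Measure S) (k : ℕ) :
    0 ≤ phiMixing P ξ stat k :=
  Real.iSup_nonneg fun _ => mul_nonneg zero_le_two (tvDist_nonneg _ _)

theorem two_mul_tvDist_le_phiMixing {P : Measure Ω} [IsProbabilityMeasure P] {ξ : ℕ → Ω → S}
    (hξ : ∀ t, 1 ≤ t → Measurable (ξ t)) (stat : Measure S) [IsProbabilityMeasure stat]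
    (k : ℕ) {t : ℕ} (ht : 1 ≤ t) {B : Set Ω} (hB : MeasurableSet[pastSigma ξ t] B)
    (hPB : P B ≠ 0) :
    2 * tvDist ((P[|B]).map (ξ (t + k))) stat ≤ phiMixing P ξ stat k := by
  -- A real supremum of an unbounded family is `0` by convention, so the bound `2` is essential
  -- here.
  refine le_ciSup (f := fun p : {p : ℕ × Set Ω // 1 ≤ p.1 ∧ MeasurableSet[pastSigma ξ p.1] p.2 ∧
    P p.2 ≠ 0} => 2 * tvDist ((P[|p.1.2]).map (ξ (p.1.1 + k))) stat) ⟨2, ?_⟩ ⟨(t, B), ht, hB, hPB⟩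
  rintro _ ⟨⟨⟨t', B'⟩, ht', hB', hPB'⟩, rfl⟩
  have := isProbabilityMeasure_map_cond hPB' (hξ (t' + k) (le_add_right ht'))
  linarith [tvDist_le_one ((P[|B']).map (ξ (t' + k))) stat]

/-- Conditionally on an event of the past, the expectation of a function with values in `[0, M]`
is controlled by the stationary expectation and the mixing coefficient. -/
theorem setLIntegral_le_of_phiMixing {P : Measure Ω} [IsProbabilityMeasure P] {ξ : ℕ → Ω → S}
    (hξ : ∀ t, 1 ≤ t → Measurable (ξ t)) (stat : Measure S) [IsProbabilityMeasure stat]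
    (k : ℕ) {t : ℕ} (ht : 1 ≤ t) {B : Set Ω} (hB : MeasurableSet[pastSigma ξ t] B)
    {f : S → ℝ} (hf : Measurable f) (h0 : ∀ s, 0 ≤ f s) {M : ℝ} (hM0 : 0 ≤ M)
    (hM : ∀ᵐ ω ∂P, f (ξ (t + k) ω) ≤ M) :
    ∫⁻ ω in B, ENNReal.ofReal (f (ξ (t + k) ω)) ∂P
      ≤ (∫⁻ s, ENNReal.ofReal (f s) ∂stat
          + ENNReal.ofReal (M / 2 * phiMixing P ξ stat k)) * P B := by
  by_cases hPB : P B = 0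
  · rw [setLIntegral_measure_zero _ _ hPB]; exact zero_le
  have hY := hξ (t + k) (le_add_right ht)
  have := isProbabilityMeasure_map_cond hPB hY
  have hae : ∀ᵐ s ∂((P[|B]).map (ξ (t + k))), f s ≤ M := by
    refine (ae_map_iff hY.aemeasurable (p := fun s => f s ≤ M) (hf measurableSet_Iic)).2 ?_
    exact cond_absolutelyContinuous.ae_le hM
  have h := lintegral_le_add_tvDist ((P[|B]).map (ξ (t + k))) stat hf h0 hae
  rw [lintegral_map hf.ennreal_ofReal hY, ProbabilityTheory.cond, lintegral_smul_measure,
    smul_eq_mul] at h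
  have h' : (P B)⁻¹ * ∫⁻ ω in B, ENNReal.ofReal (f (ξ (t + k) ω)) ∂P
      ≤ ∫⁻ s, ENNReal.ofReal (f s) ∂stat + ENNReal.ofReal (M / 2 * phiMixing P ξ stat k) := by
    refine h.trans ?_
    gcongr
    rw [← ENNReal.ofReal_mul hM0]
    apply ENNReal.ofReal_le_ofReal
    have := two_mul_tvDist_le_phiMixing hξ stat k ht hB hPB
    rw [ProbabilityTheory.cond] at this
    nlinarith
  rw [mul_comm, ← div_eq_mul_inv] at h'
  exact (ENNReal.div_le_iff hPB (measure_ne_top P B)).1 h'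

/-- If `Z` has conditional expectation at most one given `m`, as tested on events, then the same
holds tested on nonnegative functions. -/
theorem lintegral_mul_le_of_setLIntegral_le {P : Measure Ω} [IsFiniteMeasure P]
    {m : MeasurableSpace Ω} (hm : m ≤ mΩ) {Z h : Ω → ℝ≥0∞} (hZ : Measurable[mΩ] Z)
    (hZP : ∀ B, MeasurableSet[m] B → ∫⁻ ω in B, Z ω ∂P ≤ P B) (hh : Measurable[m] h) :
    ∫⁻ ω, h ω * Z ω ∂P ≤ ∫⁻ ω, h ω ∂P := by
  -- The hypothesis on events is an inequality of measures on `m`; integrating `h` against both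
  -- sides gives the claim.
  have hle : (P.withDensity Z).trim hm ≤ P.trim hm := by
    refine Measure.le_iff.2 fun B hB => ?_
    rw [trim_measurableSet_eq hm hB, trim_measurableSet_eq hm hB, withDensity_apply _ (hm B hB)]
    exact hZP B hB
  have := lintegral_mono' hle (le_refl h)
  rw [lintegral_trim hm hh, lintegral_trim hm hh,
    lintegral_withDensity_eq_lintegral_mul P hZ (hh.mono hm le_rfl)] at this
  simpa [mul_comm] using this

/-- Conditioning with a countable-valued parameter known to the past. -/
theorem setLIntegral_le_of_countable_parameter {P : Measure Ω} {m : MeasurableSpace Ω}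
    (hm : m ≤ mΩ) {I : Ω → ℕ} (hI : Measurable[m] I) {g : ℕ → Ω → ℝ≥0∞}
    (hg : ∀ k B, MeasurableSet[m] B → ∫⁻ ω in B, g k ω ∂P ≤ P B)
    {B : Set Ω} (hB : MeasurableSet[m] B) :
    ∫⁻ ω in B, g (I ω) ω ∂P ≤ P B := by
  have hBk : ∀ k, MeasurableSet[m] (B ∩ I ⁻¹' {k}) := fun k =>
    MeasurableSet.inter hB (hI (measurableSet_singleton k))
  have hd : Pairwise (Function.onFun Disjoint fun k => B ∩ I ⁻¹' {k}) := fun i j hij =>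
    Set.disjoint_left.2 fun ω hi hj => hij (hi.2.symm.trans hj.2)
  have hU : B = ⋃ k, B ∩ I ⁻¹' {k} := by ext ω; simp
  calc ∫⁻ ω in B, g (I ω) ω ∂P = ∫⁻ ω in ⋃ k, B ∩ I ⁻¹' {k}, g (I ω) ω ∂P := by rw [← hU]
    _ = ∑' k, ∫⁻ ω in B ∩ I ⁻¹' {k}, g (I ω) ω ∂P :=
        lintegral_iUnion (fun k => hm _ (hBk k)) hd _
    _ = ∑' k, ∫⁻ ω in B ∩ I ⁻¹' {k}, g k ω ∂P := by
        refine tsum_congr fun k => setLIntegral_congr_fun (hm _ (hBk k)) fun ω hω => ?_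
        have : I ω = k := hω.2
        simp only [this]
    _ ≤ ∑' k, P (B ∩ I ⁻¹' {k}) := ENNReal.tsum_le_tsum fun k => hg k _ (hBk k)
    _ = P (⋃ k, B ∩ I ⁻¹' {k}) := (measure_iUnion hd fun k => hm _ (hBk k)).symm
    _ = P B := by rw [← hU]

/-- Peel off the last factor: its predecessors lie at least `τ` steps earlier, so their product is
known when that factor is conditioned. -/
theorem lintegral_prod_le_one {P : Measure Ω} [IsProbabilityMeasure P]
    {𝓖 : ℕ → MeasurableSpace Ω} (hmono : Monotone 𝓖) {τ : ℕ} {Z : ℕ → Ω → ℝ≥0∞}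
    (hZ : ∀ t, Measurable[𝓖 (t + τ)] (Z t))
    (hstep : ∀ t (h : Ω → ℝ≥0∞), Measurable[𝓖 t] h →
      ∫⁻ ω, h ω * Z t ω ∂P ≤ ∫⁻ ω, h ω ∂P) (j N : ℕ) :
    ∫⁻ ω, ∏ i ∈ Finset.range N, Z (τ * i + j) ω ∂P ≤ 1 := by
  induction N with
  | zero => simp
  | succ N ih =>
    simp only [Finset.prod_range_succ]
    refine (hstep _ _ ?_).trans ih
    refine Finset.measurable_fun_prod _ fun i hi => (hZ _).mono (hmono ?_) le_rfl
    have := Finset.mem_range.1 hi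
    nlinarith

theorem sum_range_mul_eq_sum_residues (y : ℕ → ℝ) (τ N : ℕ) :
    ∑ t ∈ Finset.range (τ * N), y t
      = ∑ j ∈ Finset.range τ, ∑ i ∈ Finset.range N, y (τ * i + j) := by
  induction N with
  | zero => simp
  | succ N ih =>
    simp only [Finset.sum_range_succ, Nat.mul_succ, Finset.sum_add_distrib, Finset.sum_range_add,
      ih]

/-- Jensen over the `τ` residue classes. It avoids a union bound, so the deviation carries `log
(1/δ)` rather than `log (τ/δ)`. -/
theorem exp_average_le {τ : ℕ} (hτ : 0 < τ) (a : ℕ → ℝ) :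
    Real.exp ((∑ j ∈ Finset.range τ, a j) / τ)
      ≤ ∑ j ∈ Finset.range τ, (τ : ℝ)⁻¹ * Real.exp (a j) := by
  have hτ' : (0 : ℝ) < τ := by exact_mod_cast hτ
  have := convexOn_exp.map_sum_le (t := Finset.range τ) (w := fun _ => (τ : ℝ)⁻¹) (p := a)
    (fun _ _ => by positivity) (by simp [hτ'.ne']) (fun _ _ => Set.mem_univ _)
  simp only [smul_eq_mul] at this
  rwa [← Finset.mul_sum, mul_comm, ← div_eq_mul_inv] at this

/-- A Chernoff bound for sums whose exponential increments have conditional expectation at most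
one given the information available `τ` steps earlier. -/
theorem measure_sum_ge_le {P : Measure Ω} [IsProbabilityMeasure P]
    {𝓖 : ℕ → MeasurableSpace Ω} (hmono : Monotone 𝓖) (h𝓖 : ∀ t, 𝓖 t ≤ mΩ) {τ : ℕ} (hτ : 0 < τ)
    {Y : ℕ → Ω → ℝ} (hY : ∀ t, Measurable[𝓖 (t + τ)] (Y t))
    (hstep : ∀ t B, MeasurableSet[𝓖 t] B →
      ∫⁻ ω in B, ENNReal.ofReal (Real.exp (Y t ω)) ∂P ≤ P B)
    (N : ℕ) {δ : ℝ} (hδ : 0 < δ) :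
    P {ω | τ * Real.log (1 / δ) ≤ ∑ t ∈ Finset.range (τ * N), Y t ω} ≤ ENNReal.ofReal δ := by
  have hτ' : (0 : ℝ) < τ := by exact_mod_cast hτ
  have hYm : ∀ t, Measurable (Y t) := fun t => (hY t).mono (h𝓖 _) le_rfl
  set W : Ω → ℝ≥0∞ := fun ω =>
    ENNReal.ofReal (Real.exp ((∑ t ∈ Finset.range (τ * N), Y t ω) / τ)) with hW
  have hWm : Measurable W := by
    have : Measurable fun ω => ∑ t ∈ Finset.range (τ * N), Y t ω :=
      Finset.measurable_fun_sum _ fun t _ => hYm t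
    exact (Real.measurable_exp.comp (this.div_const _)).ennreal_ofReal
  have hint : ∫⁻ ω, W ω ∂P ≤ 1 := by
    have hZ : ∀ t, Measurable[𝓖 (t + τ)] fun ω => ENNReal.ofReal (Real.exp (Y t ω)) := fun t =>
      (Real.measurable_exp.comp (hY t)).ennreal_ofReal
    have hchain : ∀ j, ∫⁻ ω, ∏ i ∈ Finset.range N,
        ENNReal.ofReal (Real.exp (Y (τ * i + j) ω)) ∂P ≤ 1 := fun j =>
      lintegral_prod_le_one hmono hZ (fun t h hh =>
        lintegral_mul_le_of_setLIntegral_le (h𝓖 t) ((hZ t).mono (h𝓖 _) le_rfl) (hstep t) hh) j N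
    calc ∫⁻ ω, W ω ∂P
        ≤ ∫⁻ ω, ∑ j ∈ Finset.range τ, ENNReal.ofReal (τ : ℝ)⁻¹ *
            ∏ i ∈ Finset.range N, ENNReal.ofReal (Real.exp (Y (τ * i + j) ω)) ∂P := by
          refine lintegral_mono fun ω => ?_
          have h1 := exp_average_le hτ fun j => ∑ i ∈ Finset.range N, Y (τ * i + j) ω
          rw [← sum_range_mul_eq_sum_residues (fun t => Y t ω)] at h1
          refine (ENNReal.ofReal_le_ofReal h1).trans ?_
          rw [ENNReal.ofReal_sum_of_nonneg fun j _ => by positivity]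
          refine Finset.sum_le_sum fun j _ => ?_
          rw [ENNReal.ofReal_mul (by positivity), Real.exp_sum,
            ENNReal.ofReal_prod_of_nonneg fun i _ => (Real.exp_pos _).le]
      _ = ∑ j ∈ Finset.range τ, ENNReal.ofReal (τ : ℝ)⁻¹ *
            ∫⁻ ω, ∏ i ∈ Finset.range N, ENNReal.ofReal (Real.exp (Y (τ * i + j) ω)) ∂P := by
          have hm : ∀ j, Measurable fun ω =>
              ∏ i ∈ Finset.range N, ENNReal.ofReal (Real.exp (Y (τ * i + j) ω)) := fun j =>
            Finset.measurable_fun_prod _ fun i _ => (hZ _).mono (h𝓖 _) le_rfl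
          rw [lintegral_finsetSum _ fun j _ => (hm j).const_mul _]
          exact Finset.sum_congr rfl fun j _ => lintegral_const_mul _ (hm j)
      _ ≤ ∑ j ∈ Finset.range τ, ENNReal.ofReal (τ : ℝ)⁻¹ * 1 := by
          gcongr with j _
          exact hchain j
      _ = 1 := by
          simp only [mul_one, Finset.sum_const, Finset.card_range, nsmul_eq_mul]
          rw [← ENNReal.ofReal_natCast, ← ENNReal.ofReal_mul hτ'.le, mul_inv_cancel₀ hτ'.ne',
            ENNReal.ofReal_one]
  have hsub : {ω | τ * Real.log (1 / δ) ≤ ∑ t ∈ Finset.range (τ * N), Y t ω}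
      ⊆ {ω | ENNReal.ofReal (1 / δ) ≤ W ω} := fun ω hω => by
    refine ENNReal.ofReal_le_ofReal ?_
    rw [← Real.exp_log (by positivity : 0 < 1 / δ)]
    refine Real.exp_le_exp.2 ?_
    rw [le_div_iff₀ hτ', mul_comm]
    exact hω
  refine (measure_mono hsub).trans ?_
  have hM := (mul_meas_ge_le_lintegral (μ := P) hWm (ENNReal.ofReal (1 / δ))).trans hint
  calc P {ω | ENNReal.ofReal (1 / δ) ≤ W ω}
      = ENNReal.ofReal δ * (ENNReal.ofReal (1 / δ) * P {ω | ENNReal.ofReal (1 / δ) ≤ W ω}) := by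
        rw [← mul_assoc, ← ENNReal.ofReal_mul hδ.le, mul_one_div_cancel hδ.ne',
          ENNReal.ofReal_one, one_mul]
    _ ≤ ENNReal.ofReal δ * 1 := by gcongr
    _ = ENNReal.ofReal δ := mul_one _

end Probability

/-! ### Properties of the risk and the one-step exponential bound -/

section Risk

variable {S E : Type*} [MeasurableSpace S] [NormedAddCommGroup E] [NormedSpace ℝ E]
  {X : Set E} {F : E → S → ℝ} {ν stat : Measure S} {G R lam : ℝ}

theorem BoundedLoss.integrable (hb : BoundedLoss X F ν G R) [IsProbabilityMeasure stat]
    (hstat : stat ≪ ν) (hF : ∀ y ∈ X, Measurable (F y)) {u : E} (hu : u ∈ X) :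
    Integrable (F u) stat := by
  refine Integrable.of_bound (hF u hu).aestronglyMeasurable (G * R) ?_
  filter_upwards [hstat.ae_le hb.range] with s hs
  rw [Real.norm_eq_abs, abs_of_nonneg (hs u hu).1]
  exact (hs u hu).2

theorem BoundedLoss.abs_risk_sub_le (hb : BoundedLoss X F ν G R) [IsProbabilityMeasure stat]
    (hstat : stat ≪ ν) (hF : ∀ y ∈ X, Measurable (F y)) {u v : E} (hu : u ∈ X) (hv : v ∈ X) :
    |risk F stat u - risk F stat v| ≤ G * ‖u - v‖ := by
  rw [risk, risk, ← integral_sub (hb.integrable hstat hF hu) (hb.integrable hstat hF hv)]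
  have := norm_integral_le_of_norm_le_const (μ := stat) (f := fun s => F u s - F v s)
    (C := G * ‖u - v‖) (by
      filter_upwards [hstat.ae_le hb.lipschitz] with s hs
      exact hs u hu v hv)
  simpa using this

theorem BoundedLoss.convexOn_risk (hb : BoundedLoss X F ν G R) [IsProbabilityMeasure stat]
    (hstat : stat ≪ ν) (hF : ∀ y ∈ X, Measurable (F y)) : ConvexOn ℝ X (risk F stat) := by
  have hc := hstat.ae_le hb.convex
  -- Convexity of `X` is part of `ConvexOn`, and almost every sample provides it; one sample is
  -- enough.
  have hX : Convex ℝ X := (Filter.Eventually.exists hc).choose_spec.1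
  refine ⟨hX, fun u hu v hv a b ha hb' hab => ?_⟩
  have hiu := (hb.integrable hstat hF hu).const_mul a
  have hiv := (hb.integrable hstat hF hv).const_mul b
  calc risk F stat (a • u + b • v) ≤ ∫ s, (a * F u s + b * F v s) ∂stat := by
        refine integral_mono_ae (hb.integrable hstat hF (hX hu hv ha hb' hab)) (hiu.add hiv) ?_
        filter_upwards [hc] with s hs
        exact hs.2 hu hv ha hb' hab
    _ = a • risk F stat u + b • risk F stat v := by
        rw [integral_add hiu hiv, integral_const_mul, integral_const_mul]; rfl

/-- At a minimizer the zero functional is a subgradient. -/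
theorem StronglyConvex.quadratic_growth {f : E → ℝ} (hs : StronglyConvex X f lam) {u v : E}
    (hu : u ∈ X) (hmin : IsMinOn f X u) (hv : v ∈ X) : lam / 2 * ‖v - u‖ ^ 2 ≤ f v - f u := by
  have h := hs u hu v hv 0 fun y hy => by simpa using hmin hy
  rw [norm_sub_rev]
  simp only [_root_.zero_apply] at h
  linarith

-- Quadratic growth against linear growth confines points to distance `2 G / lam`. This intrinsic
-- radius replaces `R`, which does not enter the final bound.
omit [NormedSpace ℝ E] in
theorem norm_sub_le_of_quadratic_growth {f : E → ℝ} (hlam : 0 < lam) (hG : 0 ≤ G) {u v : E}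
    (hq : lam / 2 * ‖v - u‖ ^ 2 ≤ f v - f u) (hl : |f v - f u| ≤ G * ‖v - u‖) :
    ‖v - u‖ ≤ 2 * G / lam := by
  rw [le_div_iff₀ hlam]
  have h1 := (hq.trans (le_abs_self _)).trans hl
  rcases (norm_nonneg (v - u)).eq_or_lt with h0 | h0
  · rw [← h0]; linarith
  · have : (lam / 2 * ‖v - u‖) * ‖v - u‖ ≤ G * ‖v - u‖ := by linarith
    linarith [le_of_mul_le_mul_right this h0]

/-- From `1 - x ≤ exp (-x)` one gets `exp x * (1 - x) ≤ 1`. -/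
theorem exp_le_two {x : ℝ} (hx : x ≤ 1 / 2) : Real.exp x ≤ 2 := by
  have h1 : Real.exp x * Real.exp (-x) = 1 := by rw [← Real.exp_add]; simp
  have h2 := Real.add_one_le_exp (-x)
  nlinarith [Real.exp_pos x]

/-- Bernstein-type bound: a loss difference whose square is dominated by its mean `Δ` has a
Laplace transform decaying like `exp (-η Δ / 2)`. -/
theorem lintegral_exp_neg_le [IsProbabilityMeasure stat] {l : S → ℝ} (hl : Integrable l stat)
    {η Δ : ℝ} (h1 : ∀ᵐ s ∂stat, |η * l s| ≤ 1) (h2 : ∀ᵐ s ∂stat, (η * l s) ^ 2 ≤ η * Δ / 2)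
    (hΔ : ∫ s, l s ∂stat = Δ) :
    ∫⁻ s, ENNReal.ofReal (Real.exp (-(η * l s))) ∂stat
      ≤ ENNReal.ofReal (Real.exp (-(η * Δ / 2))) := by
  -- This is `exp y ≤ 1 + y + y²` for `|y| ≤ 1`, at `y = -(η * l s)`.
  have hle : ∀ᵐ s ∂stat, Real.exp (-(η * l s)) ≤ (1 + η * Δ / 2) - η * l s := by
    filter_upwards [h1, h2] with s hs1 hs2
    have := Real.abs_exp_sub_one_sub_id_le (x := -(η * l s)) (by rwa [abs_neg])
    linarith [le_abs_self (Real.exp (-(η * l s)) - 1 - -(η * l s)), neg_sq (η * l s)]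
  have hint : Integrable (fun s => (1 + η * Δ / 2) - η * l s) stat :=
    (integrable_const _).sub (hl.const_mul η)
  calc ∫⁻ s, ENNReal.ofReal (Real.exp (-(η * l s))) ∂stat
      ≤ ∫⁻ s, ENNReal.ofReal ((1 + η * Δ / 2) - η * l s) ∂stat := by
        refine lintegral_mono_ae ?_
        filter_upwards [hle] with s hs using ENNReal.ofReal_le_ofReal hs
    _ = ENNReal.ofReal (∫ s, ((1 + η * Δ / 2) - η * l s) ∂stat) := by
        refine (ofReal_integral_eq_lintegral_ofReal hint ?_).symm
        filter_upwards [hle] with s hs using (Real.exp_pos _).le.trans hs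
    _ ≤ ENNReal.ofReal (Real.exp (-(η * Δ / 2))) := by
        apply ENNReal.ofReal_le_ofReal
        rw [integral_sub (integrable_const _) (hl.const_mul η), integral_const_mul, hΔ]
        simp only [integral_const, probReal_univ, smul_eq_mul, one_mul]
        linarith [Real.add_one_le_exp (-(η * Δ / 2))]

/-- One step of the exponential supermartingale for a fixed predictor `u`. -/
theorem setLIntegral_exp_le {Ω : Type*} [MeasurableSpace Ω] {P : Measure Ω}
    [IsProbabilityMeasure P] {ξ : ℕ → Ω → S} (hξ : ∀ t, 1 ≤ t → Measurable (ξ t))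
    (hlaw : ∀ t, 1 ≤ t → P.map (ξ t) ≪ ν) [IsProbabilityMeasure stat] (hstat : stat ≪ ν)
    (hF : ∀ y ∈ X, Measurable (F y)) (hG : 0 < G) (hlam : 0 < lam)
    (hb : BoundedLoss X F ν G R) (hs : StronglyConvex X (risk F stat) lam) {u xstar : E}
    (hu : u ∈ X) (hx : xstar ∈ X) (hmin : IsMinOn (risk F stat) X xstar)
    (k : ℕ) {t : ℕ} (ht : 1 ≤ t) {B : Set Ω} (hB : MeasurableSet[pastSigma ξ t] B) :
    ∫⁻ ω in B, ENNReal.ofReal (Real.exp (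
        lam / (4 * G ^ 2) * (risk F stat u - risk F stat xstar) / 2
          - lam / (4 * G ^ 2) * (F u (ξ (t + k) ω) - F xstar (ξ (t + k) ω))
          - 2 * phiMixing P ξ stat k)) ∂P ≤ P B := by
  -- This value gives both `η G d ≤ 1/2` and `(η G d)² = η (lam / 2 * d²) / 2 ≤ η Δ / 2`.
  set η := lam / (4 * G ^ 2) with hη
  set Δ := risk F stat u - risk F stat xstar with hΔ
  set φ := phiMixing P ξ stat k with hφ
  set d := ‖u - xstar‖ with hd
  have hφ0 : 0 ≤ φ := phiMixing_nonneg P ξ stat k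
  have hη0 : 0 < η := by positivity
  have hq : lam / 2 * d ^ 2 ≤ Δ := hs.quadratic_growth hx hmin hu
  have hlip : |Δ| ≤ G * d := hb.abs_risk_sub_le hstat hF hu hx
  have hd2 : d ≤ 2 * G / lam := norm_sub_le_of_quadratic_growth hlam hG.le hq hlip
  have hηGd : η * (G * d) ≤ 1 / 2 := by
    calc η * (G * d) ≤ η * (G * (2 * G / lam)) := by gcongr
      _ = 1 / 2 := by rw [hη]; field_simp; norm_num
  have hpt : ∀ s, (∀ v ∈ X, ∀ w ∈ X, |F v s - F w s| ≤ G * ‖v - w‖) →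
      |η * (F u s - F xstar s)| ≤ η * (G * d) := fun s h => by
    rw [abs_mul, abs_of_pos hη0]
    exact mul_le_mul_of_nonneg_left (h u hu xstar hx) hη0.le
  have hmeas : Measurable fun s => F u s - F xstar s := (hF u hu).sub (hF xstar hx)
  have hlaplace : ∫⁻ s, ENNReal.ofReal (Real.exp (-(η * (F u s - F xstar s)))) ∂stat
      ≤ ENNReal.ofReal (Real.exp (-(η * Δ / 2))) := by
    refine lintegral_exp_neg_le ((hb.integrable hstat hF hu).sub (hb.integrable hstat hF hx))
      ?_ ?_ (integral_sub (hb.integrable hstat hF hu) (hb.integrable hstat hF hx))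
    · filter_upwards [hstat.ae_le hb.lipschitz] with s h
      exact (hpt s h).trans (hηGd.trans (by norm_num))
    · filter_upwards [hstat.ae_le hb.lipschitz] with s h
      calc (η * (F u s - F xstar s)) ^ 2 ≤ (η * (G * d)) ^ 2 := sq_le_sq' (by
              linarith [neg_abs_le (η * (F u s - F xstar s)), hpt s h])
              ((le_abs_self _).trans (hpt s h))
        _ = η * (lam / 2 * d ^ 2) / 2 := by rw [hη]; field_simp; ring
        _ ≤ η * Δ / 2 := by gcongr
  have hξb : ∀ᵐ ω ∂P, Real.exp (-(η * (F u (ξ (t + k) ω) - F xstar (ξ (t + k) ω)))) ≤ 2 := by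
    filter_upwards [ae_of_ae_map (hξ (t + k) (le_add_right ht)).aemeasurable
      ((hlaw (t + k) (le_add_right ht)).ae_le hb.lipschitz)] with ω h
    exact exp_le_two (by
      linarith [neg_abs_le (η * (F u (ξ (t + k) ω) - F xstar (ξ (t + k) ω))), hpt _ h])
  have hmix := setLIntegral_le_of_phiMixing hξ stat k ht hB
    (f := fun s => Real.exp (-(η * (F u s - F xstar s))))
    (Real.measurable_exp.comp (hmeas.const_mul η).neg) (fun s => (Real.exp_pos _).le)
    zero_le_two hξb
  rw [← hφ] at hmix
  have hsplit : ∀ ω, ENNReal.ofReal (Real.exp (η * Δ / 2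
        - η * (F u (ξ (t + k) ω) - F xstar (ξ (t + k) ω)) - 2 * φ))
      = ENNReal.ofReal (Real.exp (η * Δ / 2 - 2 * φ)) *
        ENNReal.ofReal (Real.exp (-(η * (F u (ξ (t + k) ω) - F xstar (ξ (t + k) ω))))) := fun ω => by
    rw [← ENNReal.ofReal_mul (Real.exp_pos _).le, ← Real.exp_add]
    congr 2
    ring
  simp only [hsplit]
  rw [lintegral_const_mul' _ _ ENNReal.ofReal_ne_top]
  -- The exponential is at most `2`, so mixing costs `φ`. Since `exp (η Δ / 2) ≤ 2`, the product is
  -- at most `exp (-2φ) (1 + 2φ) ≤ 1`, which explains the compensator `2φ`.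
  have hconst : Real.exp (η * Δ / 2 - 2 * φ) * (Real.exp (-(η * Δ / 2)) + 2 / 2 * φ) ≤ 1 := by
    have h1 : Real.exp (η * Δ / 2 - 2 * φ) * Real.exp (-(η * Δ / 2)) = Real.exp (-(2 * φ)) := by
      rw [← Real.exp_add]; congr 1; ring
    have h2 : Real.exp (η * Δ / 2 - 2 * φ) = Real.exp (η * Δ / 2) * Real.exp (-(2 * φ)) := by
      rw [← Real.exp_add]; congr 1
    have h3 : Real.exp (η * Δ / 2) ≤ 2 := exp_le_two (by
      have : η * Δ ≤ η * (G * d) := by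
        gcongr
        exact (le_abs_self _).trans hlip
      linarith)
    have h4 : Real.exp (-(2 * φ)) * Real.exp (2 * φ) = 1 := by rw [← Real.exp_add]; simp
    have h5 := Real.add_one_le_exp (2 * φ)
    have h6 : 0 < Real.exp (-(2 * φ)) := Real.exp_pos _
    calc Real.exp (η * Δ / 2 - 2 * φ) * (Real.exp (-(η * Δ / 2)) + 2 / 2 * φ)
        = Real.exp (-(2 * φ)) + Real.exp (η * Δ / 2) * φ * Real.exp (-(2 * φ)) := by
          rw [mul_add, h1, h2]; ring
      _ ≤ Real.exp (-(2 * φ)) + 2 * φ * Real.exp (-(2 * φ)) := by gcongr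
      _ = Real.exp (-(2 * φ)) * (2 * φ + 1) := by ring
      _ ≤ Real.exp (-(2 * φ)) * Real.exp (2 * φ) := by gcongr
      _ = 1 := h4
  calc ENNReal.ofReal (Real.exp (η * Δ / 2 - 2 * φ)) * ∫⁻ ω in B,
        ENNReal.ofReal (Real.exp (-(η * (F u (ξ (t + k) ω) - F xstar (ξ (t + k) ω))))) ∂P
      ≤ ENNReal.ofReal (Real.exp (η * Δ / 2 - 2 * φ)) *
        ((ENNReal.ofReal (Real.exp (-(η * Δ / 2))) + ENNReal.ofReal (2 / 2 * φ)) * P B) := by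
        gcongr
        exact hmix.trans (by gcongr)
    _ = ENNReal.ofReal (Real.exp (η * Δ / 2 - 2 * φ) * (Real.exp (-(η * Δ / 2)) + 2 / 2 * φ))
          * P B := by
        rw [ENNReal.ofReal_mul (Real.exp_pos _).le,
          ENNReal.ofReal_add (Real.exp_pos _).le (by positivity), mul_assoc]
    _ ≤ 1 * P B := by
        gcongr
        exact ENNReal.ofReal_le_one.2 hconst
    _ = P B := one_mul _

omit [NormedSpace ℝ E] in
/-- A measurable rounding of a compact set to countably many of its points. -/
theorem exists_measurable_rounding [MeasurableSpace E] [BorelSpace E] (hX : IsCompact X)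
    (hne : X.Nonempty) {ε : ℝ} (hε : 0 < ε) :
    ∃ (e : ℕ → E) (I : E → ℕ), Measurable I ∧ (∀ k, e k ∈ X) ∧ ∀ x ∈ X, ‖e (I x) - x‖ ≤ ε := by
  classical
  obtain ⟨s, hsX, hfin, hcov⟩ := hX.finite_cover_balls hε
  have hs : s.Nonempty := by
    obtain ⟨x, hx⟩ := hne
    obtain ⟨y, hy, -⟩ := Set.mem_iUnion₂.1 (hcov hx)
    exact ⟨y, hy⟩
  obtain ⟨e, rfl⟩ := hfin.countable.exists_eq_range hs
  -- Take the first ball containing `x`. Adjoining `Xᶜ` makes the index defined everywhere while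
  -- keeping each set measurable.
  have hp : ∀ x : E, ∃ k, x ∈ Metric.ball (e k) ε ∪ Xᶜ := fun x => by
    by_cases hx : x ∈ X
    · obtain ⟨_, ⟨k, rfl⟩, hk⟩ := Set.mem_iUnion₂.1 (hcov hx)
      exact ⟨k, Or.inl hk⟩
    · exact ⟨0, Or.inr hx⟩
  refine ⟨e, fun x => Nat.find (hp x), measurable_find hp fun k => ?_, fun k => hsX ⟨k, rfl⟩,
    fun x hx => ?_⟩
  · exact measurableSet_ball.union hX.measurableSet.compl
  · have := (Nat.find_spec (hp x)).resolve_right (fun h => h hx)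
    rw [Metric.mem_ball, dist_comm, dist_eq_norm] at this
    exact this.le

end Risk

/-! ### Deterministic summation estimates -/

theorem sum_Icc_one_eq_sum_range (f : ℕ → ℝ) (n : ℕ) :
    ∑ t ∈ Finset.Icc 1 n, f t = ∑ i ∈ Finset.range n, f (i + 1) := by
  induction n with
  | zero => simp
  | succ n ih => rw [Finset.sum_Icc_succ_top (by omega), ih, Finset.sum_range_succ]

/-- Shifting the samples by `d` changes the cumulative loss of a stable sequence by little. -/
theorem sum_shift_le {a : ℕ → ℕ → ℝ} {b : ℝ} {c : ℕ → ℝ} {m : ℕ}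
    (hab : ∀ t s, 1 ≤ t → t ≤ m + 1 → 1 ≤ s → |a t s| ≤ b)
    (hc : ∀ t s, 1 ≤ t → t < m + 1 → 1 ≤ s → a t s - a (t + 1) s ≤ c t) (d : ℕ) :
    ∑ t ∈ Finset.Icc 1 (m + 1), a t (t + d)
      ≤ ∑ t ∈ Finset.Icc 1 (m + 1), a t t + d * (∑ t ∈ Finset.Icc 1 m, c t + 2 * b) := by
  induction d with
  | zero => simp
  | succ d ih =>
    have h1 : ∑ t ∈ Finset.Icc 1 (m + 1), a t (t + (d + 1))
        ≤ ∑ t ∈ Finset.Icc 1 (m + 1), a t (t + d) + (∑ t ∈ Finset.Icc 1 m, c t + 2 * b) := by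
      simp only [sum_Icc_one_eq_sum_range]
      rw [Finset.sum_range_succ, Finset.sum_range_succ' (fun i => a (i + 1) (i + 1 + d))]
      -- Compare `w(t)` with `w(t+1)` on the same sample. The two unpaired end terms cost `b` each.
      have h2 : ∑ i ∈ Finset.range m, a (i + 1) (i + 1 + (d + 1))
          ≤ ∑ i ∈ Finset.range m, (a (i + 1 + 1) (i + 1 + 1 + d) + c (i + 1)) := by
        refine Finset.sum_le_sum fun i hi => ?_
        have := Finset.mem_range.1 hi
        have := hc (i + 1) (i + 1 + (d + 1)) (by omega) (by omega) (by omega)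
        rw [show i + 1 + 1 + d = i + 1 + (d + 1) by omega]
        linarith
      rw [Finset.sum_add_distrib] at h2
      have h3 := (abs_le.1 (hab (m + 1) (m + 1 + (d + 1)) (by omega) le_rfl (by omega))).2
      have h4 := (abs_le.1 (hab (0 + 1) (0 + 1 + d) (by omega) (by omega) (by omega))).1
      linarith
    push_cast
    linarith

theorem sum_inv_le_one_add_log (n : ℕ) :
    ∑ t ∈ Finset.Icc 1 n, (t : ℝ)⁻¹ ≤ 1 + Real.log n := by
  have h := harmonic_le_one_add_log n
  rw [harmonic_eq_sum_Icc] at h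
  push_cast at h
  exact h

/-- Deterministic part of the argument: from a bound on the decoupled sum to a bound on the
cumulative excess risk. -/
theorem sum_excess_le_of_decoupled {Δ : ℕ → ℝ} {a : ℕ → ℕ → ℝ} {D φ r ρ : ℝ} {m d : ℕ}
    (hD : 0 ≤ D) (hlog : 1 ≤ Real.log (m + 1 : ℕ))
    (hΔ : Δ 1 ≤ 2 * D)
    (hab : ∀ t s, 1 ≤ t → t ≤ m + 1 → 1 ≤ s → |a t s| ≤ 2 * D)
    (hc : ∀ t s, 1 ≤ t → t < m + 1 → 1 ≤ s → a t s - a (t + 1) s ≤ D * (t : ℝ)⁻¹)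
    (hr : ∑ t ∈ Finset.Icc 1 (m + 1), a t t ≤ ρ)
    (hdec : ∑ t ∈ Finset.Ioc 1 (m + 1), (Δ t / 2 - a t (t + d))
      ≤ 4 * D * (r + 2 * φ * (m + 1 : ℕ)) + 3 / 2 * D) :
    ∑ t ∈ Finset.Icc 1 (m + 1), Δ t ≤ 2 * ρ + 12 * D * d * Real.log (m + 1 : ℕ)
      + 8 * D * (r + 2 * φ * (m + 1 : ℕ)) + 9 * D := by
  have hshift := sum_shift_le hab hc d
  have hlogm : Real.log m ≤ Real.log (m + 1 : ℕ) := by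
    rcases Nat.eq_zero_or_pos m with rfl | hm
    · simp
    · exact Real.log_le_log (by exact_mod_cast hm) (by push_cast; linarith)
  have hκ : ∑ t ∈ Finset.Icc 1 m, D * (t : ℝ)⁻¹ ≤ D * (1 + Real.log (m + 1 : ℕ)) := by
    rw [← Finset.mul_sum]
    exact mul_le_mul_of_nonneg_left ((sum_inv_le_one_add_log m).trans (by linarith)) hD
  -- As `log n ≥ 1`, `(1 + log n) + 4 ≤ 6 log n`.
  have hdelay : (d : ℝ) * (∑ t ∈ Finset.Icc 1 m, D * (t : ℝ)⁻¹ + 2 * (2 * D))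
      ≤ d * (6 * D * Real.log (m + 1 : ℕ)) := by
    refine mul_le_mul_of_nonneg_left ?_ (Nat.cast_nonneg d)
    nlinarith
  -- The term `t = 1` is bounded by hand, by `D + 2D`: its past is `𝓕_0`, whereas `φ` only
  -- conditions on `𝓕_t` with `t ≥ 1`.
  have hfirst := (abs_le.1 (hab 1 (1 + d) le_rfl (by omega) (by omega))).1
  have hsplit : ∑ t ∈ Finset.Icc 1 (m + 1), (Δ t / 2 - a t (t + d))
      ≤ 4 * D * (r + 2 * φ * (m + 1 : ℕ)) + 3 / 2 * D + 3 * D := by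
    rw [← Finset.add_sum_Ioc_eq_sum_Icc (by omega)]
    linarith
  rw [Finset.sum_sub_distrib, ← Finset.sum_div] at hsplit
  linarith

/-! ### High-probability bounds for the iterates and their average -/

section HighProbability

variable {Ω : Type*} [mΩ : MeasurableSpace Ω] {P : Measure Ω} [IsProbabilityMeasure P]
  {S : Type*} [MeasurableSpace S] {E : Type*} [NormedAddCommGroup E] [NormedSpace ℝ E]
  [MeasurableSpace E] [BorelSpace E] {ξ : ℕ → Ω → S} {stat ν : Measure S}
  [IsProbabilityMeasure stat] {X : Set E} {F : E → S → ℝ} {G R lam : ℝ} {n : ℕ}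
  {x : ℕ → Ω → E} {xstar : E}

/-- With high probability, the excess risk of the iterates is controlled by their losses on
samples drawn `τ - 1` steps later. -/
theorem measure_decoupled_le (hξ : ∀ t, 1 ≤ t → Measurable (ξ t))
    (hlaw : ∀ t, 1 ≤ t → P.map (ξ t) ≪ ν) (hstat : stat ≪ ν)
    (hF : ∀ y ∈ X, Measurable (F y)) (hG : 0 < G) (hlam : 0 < lam)
    (hb : BoundedLoss X F ν G R) (hs : StronglyConvex X (risk F stat) lam)
    (hout : IsOnlineOutput X ξ x n) (hx : xstar ∈ X) (hmin : IsMinOn (risk F stat) X xstar)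
    (hn : 0 < n) (d : ℕ) {δ : ℝ} (hδ : 0 < δ) :
    P {ω | (∀ t, 1 ≤ t → ∀ v ∈ X, ∀ w ∈ X, |F v (ξ t ω) - F w (ξ t ω)| ≤ G * ‖v - w‖) ∧
      4 * (G ^ 2 / lam) * ((d + 1 : ℕ) * Real.log (1 / δ) + 2 * phiMixing P ξ stat (d + 1) * n)
        + 3 / 2 * (G ^ 2 / lam) <
        ∑ t ∈ Finset.Ioc 1 n, ((risk F stat (x t ω) - risk F stat xstar) / 2
          - (F (x t ω) (ξ (t + d) ω) - F xstar (ξ (t + d) ω)))} ≤ ENNReal.ofReal δ := by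
  set η := lam / (4 * G ^ 2) with hη
  set φ := phiMixing P ξ stat (d + 1) with hφ
  have hn' : (0 : ℝ) < n := by exact_mod_cast hn
  -- `F` is measurable only for fixed `w`, so `w(t)` is rounded to countably many points. At radius
  -- `G / (lam n)` a term moves by `(G²/lam)/n` in loss and half that in halved risk: `3/2 *
  -- (G²/lam)` over all terms.
  obtain ⟨e, I, hI, heX, he⟩ := exists_measurable_rounding hb.compact ⟨xstar, hx⟩
    (show 0 < G / (lam * n) by positivity)
  set Y : ℕ → Ω → ℝ := fun t ω => if t ∈ Finset.Ioc 1 n then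
    η * (risk F stat (e (I (x t ω))) - risk F stat xstar) / 2
      - η * (F (e (I (x t ω))) (ξ (t + d) ω) - F xstar (ξ (t + d) ω)) - 2 * φ else 0 with hYdef
  have hImeas : ∀ t ∈ Finset.Ioc 1 n, Measurable[pastSigma ξ (t - 1)] fun ω => I (x t ω) :=
    fun t ht => hI.comp (hout t (Finset.mem_Ioc.1 ht).1.le (Finset.mem_Ioc.1 ht).2).1
  have hYm : ∀ t, Measurable[pastSigma ξ (t + (d + 1) - 1)] (Y t) := fun t => by
    by_cases ht : t ∈ Finset.Ioc 1 n
    · simp only [hYdef, if_pos ht]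
      have h1 : Measurable[pastSigma ξ (t + (d + 1) - 1)] fun ω => I (x t ω) :=
        (hImeas t ht).mono (pastSigma_mono ξ (by omega)) le_rfl
      have h2 : Measurable[pastSigma ξ (t + (d + 1) - 1)] (ξ (t + d)) :=
        measurable_pastSigma ξ (by have := (Finset.mem_Ioc.1 ht).1; omega) (by omega)
      have h3 : Measurable fun p : ℕ × S => η * (risk F stat (e p.1) - risk F stat xstar) / 2
          - η * (F (e p.1) p.2 - F xstar p.2) - 2 * φ :=
        measurable_from_prod_countable_right fun k =>
          (((((hF _ (heX k)).sub (hF _ hx)).const_mul η).const_sub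
            (η * (risk F stat (e k) - risk F stat xstar) / 2)).sub_const (2 * φ))
      exact h3.comp (h1.prodMk h2)
    · simp only [hYdef, if_neg ht]
      exact measurable_const
  have hstep : ∀ t B, MeasurableSet[pastSigma ξ (t - 1)] B →
      ∫⁻ ω in B, ENNReal.ofReal (Real.exp (Y t ω)) ∂P ≤ P B := fun t B hB => by
    by_cases ht : t ∈ Finset.Ioc 1 n
    · simp only [hYdef, if_pos ht]
      refine setLIntegral_le_of_countable_parameter (pastSigma_le hξ (t - 1)) (hImeas t ht)
        (g := fun k ω => ENNReal.ofReal (Real.exp (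
          η * (risk F stat (e k) - risk F stat xstar) / 2
            - η * (F (e k) (ξ (t + d) ω) - F xstar (ξ (t + d) ω)) - 2 * φ)))
        (fun k B' hB' => ?_) hB
      have ht1 : 1 ≤ t - 1 := by have := (Finset.mem_Ioc.1 ht).1; omega
      have := setLIntegral_exp_le hξ hlaw hstat hF hG hlam hb hs (heX k) hx hmin (d + 1) ht1 hB'
      rwa [show t - 1 + (d + 1) = t + d by omega] at this
    · simp only [hYdef, if_neg ht, Real.exp_zero, ENNReal.ofReal_one, setLIntegral_one, le_refl]
  -- With `𝓖 t = 𝓕_{t-1}`, `Y t` uses `ξ_{t+d}` and is known at `t + (d + 1)`. Taking `N = n + 1`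
  -- makes the range cover every index up to `n`.
  refine (measure_mono ?_).trans (measure_sum_ge_le (τ := d + 1)
    (fun _ _ h => pastSigma_mono ξ (Nat.sub_le_sub_right h 1)) (fun t => pastSigma_le hξ (t - 1))
    (Nat.succ_pos d) hYm hstep (n + 1) hδ)
  rintro ω ⟨hlip, hω⟩
  by_contra hlt
  rw [Set.mem_ofPred_eq, not_le] at hlt
  refine hω.not_ge ?_
  have hsub : Finset.Ioc 1 n ⊆ Finset.range ((d + 1) * (n + 1)) := fun t ht => by
    have := (Finset.mem_Ioc.1 ht).2
    rw [Finset.mem_range]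
    nlinarith
  rw [← Finset.sum_subset hsub fun t _ ht => by simp only [hYdef, if_neg ht]] at hlt
  have hterm : ∀ t ∈ Finset.Ioc 1 n, (risk F stat (x t ω) - risk F stat xstar) / 2
      - (F (x t ω) (ξ (t + d) ω) - F xstar (ξ (t + d) ω))
      ≤ 4 * (G ^ 2 / lam) * Y t ω + (4 * (G ^ 2 / lam) * (2 * φ)
        + 3 / 2 * (G ^ 2 / lam) / n) := fun t ht => by
    obtain ⟨ht1, htn⟩ := Finset.mem_Ioc.1 ht
    have hxt : x t ω ∈ X := (hout t ht1.le htn).2 ω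
    have hclose : G * ‖e (I (x t ω)) - x t ω‖ ≤ (G ^ 2 / lam) / n := by
      calc G * ‖e (I (x t ω)) - x t ω‖ ≤ G * (G / (lam * n)) := by gcongr; exact he _ hxt
        _ = (G ^ 2 / lam) / n := by field_simp
    have h1 := (abs_le.1 ((hb.abs_risk_sub_le hstat hF (heX (I (x t ω))) hxt).trans hclose)).1
    have h2 := (abs_le.1 ((hlip (t + d) (by omega) _ (heX (I (x t ω))) _ hxt).trans hclose)).2
    have h3 : 4 * (G ^ 2 / lam) * Y t ω
        = (risk F stat (e (I (x t ω))) - risk F stat xstar) / 2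
          - (F (e (I (x t ω))) (ξ (t + d) ω) - F xstar (ξ (t + d) ω))
          - 4 * (G ^ 2 / lam) * (2 * φ) := by
      simp only [hYdef, if_pos ht, hη]
      field_simp
    rw [h3, mul_div_assoc]
    linarith
  refine (Finset.sum_le_sum hterm).trans ?_
  have hφ0 : 0 ≤ φ := phiMixing_nonneg P ξ stat (d + 1)
  rw [Finset.sum_add_distrib, ← Finset.mul_sum, Finset.sum_const, Nat.card_Ioc, nsmul_eq_mul]
  have hcard : ((n - 1 : ℕ) : ℝ) ≤ n := by exact_mod_cast Nat.sub_le n 1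
  calc 4 * (G ^ 2 / lam) * ∑ t ∈ Finset.Ioc 1 n, Y t ω
        + ((n - 1 : ℕ) : ℝ) * (4 * (G ^ 2 / lam) * (2 * φ) + 3 / 2 * (G ^ 2 / lam) / n)
      ≤ 4 * (G ^ 2 / lam) * ((d + 1 : ℕ) * Real.log (1 / δ))
        + n * (4 * (G ^ 2 / lam) * (2 * φ) + 3 / 2 * (G ^ 2 / lam) / n) := by gcongr
    _ = _ := by field_simp; ring

omit mΩ [MeasurableSpace E] [BorelSpace E] in
theorem risk_avgPredictor_le (hstat : stat ≪ ν) (hF : ∀ y ∈ X, Measurable (F y))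
    (hb : BoundedLoss X F ν G R) {ω : Ω} (hxX : ∀ t, 1 ≤ t → t ≤ n → x t ω ∈ X) (hn : 0 < n) :
    risk F stat (avgPredictor x n ω) ≤ (n : ℝ)⁻¹ * ∑ t ∈ Finset.Icc 1 n, risk F stat (x t ω) := by
  have hn' : (n : ℝ) ≠ 0 := by exact_mod_cast hn.ne'
  rw [avgPredictor, Finset.smul_sum, Finset.mul_sum]
  exact (hb.convexOn_risk hstat hF).map_sum_le (fun _ _ => by positivity) (by simp [hn'])
    fun t ht => hxX t (Finset.mem_Icc.1 ht).1 (Finset.mem_Icc.1 ht).2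

/-- The high-probability bound for a fixed delay `d + 1`. -/
theorem measureReal_excess_risk_le (hξ : ∀ t, 1 ≤ t → Measurable (ξ t))
    (hlaw : ∀ t, 1 ≤ t → P.map (ξ t) ≪ ν) (hstat : stat ≪ ν)
    (hF : ∀ y ∈ X, Measurable (F y)) (hG : 0 < G) (hlam : 0 < lam)
    (hb : BoundedLoss X F ν G R) (hs : StronglyConvex X (risk F stat) lam)
    (hout : IsOnlineOutput X ξ x n) {κ : ℕ → ℝ} (hstab : IsStable P x κ n)
    (hκ : ∀ t : ℕ, 1 ≤ t → κ t ≤ G / (lam * t)) {Rn : Ω → ℝ}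
    (hreg : HasRegret P X F ξ x n Rn) (hx : xstar ∈ X)
    (hmin : IsMinOn (risk F stat) X xstar)
    (hn : 3 ≤ n) (hlogn : 1 ≤ Real.log n) (d : ℕ) {δ : ℝ} (hδ : 0 < δ) :
    1 - δ ≤ P.real {ω | risk F stat (avgPredictor x n ω) - risk F stat xstar
      ≤ 2 / n * Rn ω + (n : ℝ)⁻¹ * (12 * (G ^ 2 / lam) * d * Real.log n
        + 8 * (G ^ 2 / lam) * ((d + 1 : ℕ) * Real.log (1 / δ)
          + 2 * phiMixing P ξ stat (d + 1) * n) + 9 * (G ^ 2 / lam))} := by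
  set A := {ω | risk F stat (avgPredictor x n ω) - risk F stat xstar
      ≤ 2 / n * Rn ω + (n : ℝ)⁻¹ * (12 * (G ^ 2 / lam) * d * Real.log n
        + 8 * (G ^ 2 / lam) * ((d + 1 : ℕ) * Real.log (1 / δ)
          + 2 * phiMixing P ξ stat (d + 1) * n) + 9 * (G ^ 2 / lam))} with hA
  have hn' : (0 : ℝ) < n := by positivity
  have hlip : ∀ᵐ ω ∂P, ∀ t, 1 ≤ t → ∀ v ∈ X, ∀ w ∈ X,
      |F v (ξ t ω) - F w (ξ t ω)| ≤ G * ‖v - w‖ := by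
    refine ae_all_iff.2 fun t => ?_
    by_cases ht : 1 ≤ t
    · filter_upwards [ae_of_ae_map (hξ t ht).aemeasurable ((hlaw t ht).ae_le hb.lipschitz)]
        with ω hω _ using hω
    · exact .of_forall fun _ h => absurd h ht
  have hst : ∀ᵐ ω ∂P, ∀ t, 1 ≤ t → t < n → ‖x t ω - x (t + 1) ω‖ ≤ κ t := by
    refine ae_all_iff.2 fun t => ?_
    by_cases ht : 1 ≤ t ∧ t < n
    · filter_upwards [hstab.2 t ht.1 ht.2] with ω hω _ _ using hω
    · exact .of_forall fun _ h1 h2 => absurd ⟨h1, h2⟩ ht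
  have hdist : ∀ v ∈ X, ‖v - xstar‖ ≤ 2 * G / lam := fun v hv =>
    norm_sub_le_of_quadratic_growth hlam hG.le (hs.quadratic_growth hx hmin hv)
      (hb.abs_risk_sub_le hstat hF hv hx)
  have hGdist : ∀ v ∈ X, G * ‖v - xstar‖ ≤ 2 * (G ^ 2 / lam) := fun v hv => by
    calc G * ‖v - xstar‖ ≤ G * (2 * G / lam) := by gcongr; exact hdist v hv
      _ = 2 * (G ^ 2 / lam) := by ring
  have hAc : P Aᶜ ≤ ENNReal.ofReal δ := by
    refine le_trans (measure_mono_ae ?_)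
      (measure_decoupled_le hξ hlaw hstat hF hG hlam hb hs hout hx hmin (by omega) d hδ)
    filter_upwards [hlip, hst, hreg xstar hx] with ω hlipω hstω hregω hω
    refine ⟨hlipω, ?_⟩
    by_contra hdec
    rw [not_lt] at hdec
    refine hω ?_
    obtain ⟨m, rfl⟩ : ∃ m, n = m + 1 := ⟨n - 1, by omega⟩
    have hxX : ∀ t, 1 ≤ t → t ≤ m + 1 → x t ω ∈ X := fun t h1 h2 => (hout t h1 h2).2 ω
    have hsum := sum_excess_le_of_decoupled (D := G ^ 2 / lam)
      (Δ := fun t => risk F stat (x t ω) - risk F stat xstar)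
      (a := fun t s => F (x t ω) (ξ s ω) - F xstar (ξ s ω)) (by positivity) hlogn
      ((le_abs_self _).trans ((hb.abs_risk_sub_le hstat hF (hxX 1 le_rfl (by omega)) hx).trans
        (hGdist _ (hxX 1 le_rfl (by omega)))))
      (fun t s h1 h2 h3 => (hlipω s h3 _ (hxX t h1 h2) _ hx).trans (hGdist _ (hxX t h1 h2)))
      (fun t s h1 h2 h3 => by
        have h4 := (le_abs_self _).trans
          (hlipω s h3 _ (hxX t h1 (by omega)) _ (hxX (t + 1) (by omega) (by omega)))
        have h5 : G * ‖x t ω - x (t + 1) ω‖ ≤ G * (G / (lam * t)) :=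
          mul_le_mul_of_nonneg_left ((hstω t h1 h2).trans (hκ t h1)) hG.le
        have h6 : G * (G / (lam * t)) = G ^ 2 / lam * (t : ℝ)⁻¹ := by
          have : (t : ℝ) ≠ 0 := by exact_mod_cast (by omega : t ≠ 0)
          field_simp
        linarith)
      hregω hdec
    have havg := risk_avgPredictor_le hstat hF hb hxX (Nat.succ_pos m)
    rw [Finset.sum_sub_distrib, Finset.sum_const, Nat.card_Icc, nsmul_eq_mul,
      Nat.add_sub_cancel] at hsum
    rw [hA, Set.mem_ofPred_eq]
    have h7 := mul_le_mul_of_nonneg_left hsum (inv_nonneg.2 hn'.le)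
    rw [mul_sub, inv_mul_cancel_left₀ hn'.ne'] at h7
    refine (sub_le_sub_right havg _).trans (h7.trans (le_of_eq ?_))
    ring
  -- Subadditivity is enough, so measurability of `A` is not needed.
  have h1 : (1 : ℝ) ≤ P.real A + P.real Aᶜ := by
    have := measureReal_union_le (μ := P) A Aᶜ
    rwa [Set.union_compl_self, probReal_univ] at this
  have h2 : P.real Aᶜ ≤ δ := ENNReal.toReal_le_of_le_ofReal hδ.le hAc
  linarith

omit [IsProbabilityMeasure P] [BorelSpace E] in
/-- If the losses are constant on `X`, the excess risk is almost surely at most the average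
regret. -/
theorem ae_excess_risk_le_of_lipschitz_zero (hξ : ∀ t, 1 ≤ t → Measurable (ξ t))
    (hlaw : ∀ t, 1 ≤ t → P.map (ξ t) ≪ ν) (hstat : stat ≪ ν)
    (hF : ∀ y ∈ X, Measurable (F y)) (hb : BoundedLoss X F ν 0 R)
    (hout : IsOnlineOutput X ξ x n) {Rn : Ω → ℝ}
    (hreg : HasRegret P X F ξ x n Rn) (hx : xstar ∈ X) (hn : 0 < n) :
    ∀ᵐ ω ∂P, risk F stat (avgPredictor x n ω) - risk F stat xstar ≤ 2 / n * Rn ω := by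
  have hlip : ∀ᵐ ω ∂P, ∀ t, 1 ≤ t → ∀ v ∈ X, ∀ w ∈ X,
      |F v (ξ t ω) - F w (ξ t ω)| ≤ 0 * ‖v - w‖ := by
    refine ae_all_iff.2 fun t => ?_
    by_cases ht : 1 ≤ t
    · filter_upwards [ae_of_ae_map (hξ t ht).aemeasurable ((hlaw t ht).ae_le hb.lipschitz)]
        with ω hω _ using hω
    · exact .of_forall fun _ h => absurd h ht
  filter_upwards [hlip, hreg xstar hx] with ω hlipω hregω
  have hxX : ∀ t, 1 ≤ t → t ≤ n → x t ω ∈ X := fun t h1 h2 => (hout t h1 h2).2 ω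
  have hn' : (n : ℝ) ≠ 0 := by exact_mod_cast hn.ne'
  have hrisk : ∀ t ∈ Finset.Icc 1 n, risk F stat (x t ω) = risk F stat xstar := fun t ht => by
    have := hb.abs_risk_sub_le hstat hF (hxX t (Finset.mem_Icc.1 ht).1 (Finset.mem_Icc.1 ht).2) hx
    rw [zero_mul] at this
    exact sub_eq_zero.1 (abs_nonpos_iff.1 this)
  have havg := risk_avgPredictor_le hstat hF hb hxX hn
  rw [Finset.sum_congr rfl hrisk, Finset.sum_const, Nat.card_Icc, nsmul_eq_mul,
    Nat.add_sub_cancel, inv_mul_cancel_left₀ hn'] at havg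
  have h0 : ∑ t ∈ Finset.Icc 1 n, (F (x t ω) (ξ t ω) - F xstar (ξ t ω)) = 0 :=
    Finset.sum_eq_zero fun t ht => by
      obtain ⟨h1, h2⟩ := Finset.mem_Icc.1 ht
      have := hlipω t h1 _ (hxX t h1 h2) _ hx
      rw [zero_mul] at this
      exact abs_nonpos_iff.1 this
  rw [h0] at hregω
  have : 0 ≤ 2 / (n : ℝ) * Rn ω := by positivity
  linarith

end HighProbability

end OnlineMixing

/-! ### Choice of the delay and of the universal constant -/

theorem mainTheorem10 :
    ∃ C : ℝ, 0 < C ∧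
      ∀ (Ω : Type*) [MeasurableSpace Ω] (P : Measure Ω) [IsProbabilityMeasure P]
        (S : Type*) [MeasurableSpace S]
        (E : Type*) [NormedAddCommGroup E] [NormedSpace ℝ E] [MeasurableSpace E] [BorelSpace E]
        (ξ : ℕ → Ω → S) (stat ν : Measure S) [IsProbabilityMeasure stat]
        (X : Set E) (F : E → S → ℝ) (G R lam : ℝ)
        (n : ℕ) (x : ℕ → Ω → E) (κ : ℕ → ℝ) (Rn : Ω → ℝ) (xstar : E) (δ : ℝ),
        (∀ t, 1 ≤ t → Measurable (ξ t)) →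
        (∀ t, 1 ≤ t → P.map (ξ t) ≪ ν) →
        stat ≪ ν →
        (∀ y ∈ X, Measurable (F y)) →
        0 ≤ G →
        0 < lam →
        OnlineMixing.BoundedLoss X F ν G R →
        OnlineMixing.StronglyConvex X (OnlineMixing.risk F stat) lam →
        OnlineMixing.IsOnlineOutput X ξ x n →
        OnlineMixing.IsStable P x κ n →
        (∀ t : ℕ, 1 ≤ t → κ t ≤ G / (lam * t)) →
        Measurable Rn →
        OnlineMixing.HasRegret P X F ξ x n Rn →
        xstar ∈ X →
        IsMinOn (OnlineMixing.risk F stat) X xstar →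
        3 ≤ n →
        0 < δ →
        δ < 1 / Real.exp 1 →
        1 - δ * Real.log n ≤
          P.real {ω |
            OnlineMixing.risk F stat (OnlineMixing.avgPredictor x n ω)
                - OnlineMixing.risk F stat xstar ≤
              2 / n * Rn ω +
                C * ⨅ τ : ℕ+, (
                  (((τ : ℕ) : ℝ) - 1) * G ^ 2 / (lam * n) * Real.log n
                    + ((τ : ℕ) : ℝ) * G ^ 2 / (lam * n) * Real.log (((τ : ℕ) : ℝ) / δ)
                    + G ^ 2 / lam * OnlineMixing.phiMixing P ξ stat τ)} := by
  -- For fixed `τ` the terms carry factors `12`, `8 + 9 = 17` and `16`, all below `20`; a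
  -- near-minimizing `τ` costs a further factor `2`.
  refine ⟨40, by norm_num, ?_⟩
  intro Ω _ P _ S _ E _ _ _ _ ξ stat ν _ X F G R lam n x κ Rn xstar δ hξ hlaw hstat hF hG hlam hb
    hs hout hstab hκ _ hreg hx hmin hn hδ hδe
  have hn' : (0 : ℝ) < n := by positivity
  have hlogn : 1 ≤ Real.log n := by
    rw [Real.le_log_iff_exp_le hn']
    have : (3 : ℝ) ≤ n := by exact_mod_cast hn
    linarith [Real.exp_one_lt_d9]
  have hlogδ : 1 ≤ Real.log (1 / δ) := by
    rw [Real.le_log_iff_exp_le (by positivity)]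
    exact (le_one_div hδ (Real.exp_pos 1)).1 hδe.le
  have hδn : 1 - δ * Real.log n ≤ 1 - δ := by nlinarith
  set T : ℕ+ → ℝ := fun τ => (((τ : ℕ) : ℝ) - 1) * G ^ 2 / (lam * n) * Real.log n
    + ((τ : ℕ) : ℝ) * G ^ 2 / (lam * n) * Real.log (((τ : ℕ) : ℝ) / δ)
    + G ^ 2 / lam * OnlineMixing.phiMixing P ξ stat τ with hT
  -- For `G = 0` the infimum is `0` and `η` is meaningless, but the losses are almost surely
  -- constant on `X`.
  rcases hG.eq_or_lt with rfl | hG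
  · have hT0 : ∀ τ, T τ = 0 := fun τ => by simp [hT]
    have hae := OnlineMixing.ae_excess_risk_le_of_lipschitz_zero hξ hlaw hstat hF hb hout hreg hx
      (by omega)
    refine hδn.trans (le_trans (by linarith) (le_of_eq (?_ : (1 : ℝ) = _)))
    symm
    rw [← probReal_univ (μ := P)]
    refine measureReal_congr ?_
    refine Filter.eventuallyEq_univ.2 ?_
    filter_upwards [hae] with ω hω
    have hinf : iInf T = 0 := by rw [funext hT0]; exact ciInf_const
    simpa [hinf] using hω
  have hτ1 : ∀ τ : ℕ+, (1 : ℝ) ≤ (τ : ℕ) := fun τ => by exact_mod_cast τ.pos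
  have hlogτ : ∀ τ : ℕ+, Real.log (1 / δ) ≤ Real.log ((τ : ℕ) / δ) := fun τ =>
    Real.log_le_log (by positivity) (by gcongr; exact hτ1 τ)
  have hTlow : ∀ τ, G ^ 2 / (lam * n) ≤ T τ := fun τ => by
    have h1 : 0 ≤ (((τ : ℕ) : ℝ) - 1) * G ^ 2 / (lam * n) * Real.log n := by
      have : 0 ≤ ((τ : ℕ) : ℝ) - 1 := by linarith [hτ1 τ]
      positivity
    have h2 : 0 ≤ G ^ 2 / lam * OnlineMixing.phiMixing P ξ stat τ :=
      mul_nonneg (by positivity) (OnlineMixing.phiMixing_nonneg P ξ stat τ)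
    have h3 : G ^ 2 / (lam * n) ≤
        ((τ : ℕ) : ℝ) * G ^ 2 / (lam * n) * Real.log (((τ : ℕ) : ℝ) / δ) := by
      have h4 : 1 ≤ ((τ : ℕ) : ℝ) * Real.log (((τ : ℕ) : ℝ) / δ) :=
        one_le_mul_of_one_le_of_one_le (hτ1 τ) (hlogδ.trans (hlogτ τ))
      calc G ^ 2 / (lam * n) = G ^ 2 / (lam * n) * 1 := (mul_one _).symm
        _ ≤ G ^ 2 / (lam * n) * (((τ : ℕ) : ℝ) * Real.log (((τ : ℕ) : ℝ) / δ)) := by gcongr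
        _ = _ := by ring
    simp only [hT]
    linarith
  have hpos : 0 < ⨅ τ, T τ := (by positivity : 0 < G ^ 2 / (lam * n)).trans_le (le_ciInf hTlow)
  -- Attainment of the infimum is not needed: being positive, it is strictly below its double, which
  -- some `τ` therefore beats.
  obtain ⟨τ, hτ⟩ := exists_lt_of_ciInf_lt (show ⨅ τ, T τ < 2 * ⨅ τ, T τ by linarith)
  obtain ⟨d, hd⟩ : ∃ d : ℕ, (τ : ℕ) = d + 1 := ⟨τ - 1, by have := τ.pos; omega⟩
  refine hδn.trans ((OnlineMixing.measureReal_excess_risk_le hξ hlaw hstat hF hG hlam hb hs hout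
    hstab hκ hreg hx hmin hn hlogn d hδ).trans (measureReal_mono fun ω hω => ?_))
  rw [Set.mem_ofPred_eq] at hω ⊢
  refine hω.trans (add_le_add_right ?_ _)
  have hTlowτ := hTlow τ
  have hlogτ' := hlogτ τ
  have hφ0 := OnlineMixing.phiMixing_nonneg P ξ stat (d + 1)
  simp only [hT, hd] at hτ hTlowτ hlogτ'
  have h5 : (n : ℝ)⁻¹ * (12 * (G ^ 2 / lam) * d * Real.log n
        + 8 * (G ^ 2 / lam) * ((d + 1 : ℕ) * Real.log (1 / δ)
          + 2 * OnlineMixing.phiMixing P ξ stat (d + 1) * n) + 9 * (G ^ 2 / lam))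
      = 12 * (d * G ^ 2 / (lam * n) * Real.log n)
        + 8 * (((d + 1 : ℕ) : ℝ) * G ^ 2 / (lam * n) * Real.log (1 / δ))
        + 16 * (G ^ 2 / lam * OnlineMixing.phiMixing P ξ stat (d + 1))
        + 9 * (G ^ 2 / (lam * n)) := by
    field_simp
    ring
  rw [h5]
  have hdc : (((d + 1 : ℕ) : ℝ) - 1) = d := by push_cast; ring
  rw [hdc] at hτ
  have h6 : ((d + 1 : ℕ) : ℝ) * G ^ 2 / (lam * n) * Real.log (1 / δ)
      ≤ ((d + 1 : ℕ) : ℝ) * G ^ 2 / (lam * n) * Real.log ((d + 1 : ℕ) / δ) := by gcongr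
  -- The residual `9 G² / (lam n)` is absorbed by the confidence term, since `log (1/δ) ≥ 1`.
  have h7 : G ^ 2 / (lam * n) * 1
      ≤ G ^ 2 / (lam * n) * (((d + 1 : ℕ) : ℝ) * Real.log (1 / δ)) := by
    gcongr
    exact one_le_mul_of_one_le_of_one_le (by push_cast; linarith [Nat.cast_nonneg (α := ℝ) d])
      hlogδ
  have h8 : G ^ 2 / (lam * n) * (((d + 1 : ℕ) : ℝ) * Real.log (1 / δ))
      = ((d + 1 : ℕ) : ℝ) * G ^ 2 / (lam * n) * Real.log (1 / δ) := by ring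
  have h9 : 0 ≤ d * G ^ 2 / (lam * n) * Real.log n := by positivity
  have h10 : 0 ≤ G ^ 2 / lam * OnlineMixing.phiMixing P ξ stat (d + 1) := by positivity
  simp only [hT]
  linarith
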